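/- Let $\Lambda\subset\mathbb{R}^{24}$ be the Leech lattice, i.e. an even self-dual lattice of rank $24$ in Euclidean space with no vectors $x$ of norm $x^2=\langle x,x\rangle=2$. Let $V=\mathbb{R}^{24}\oplus\mathbb{R}\oplus\mathbb{R}$, with elements written $(l;m,n)$, carry the bilinear form with $(l;m,n)^2=l^2-2mn$. Let $L=\Lambda\oplus\mathrm{II}_{1,1}=\{(l;m,n): l\in\Lambda,\ m,n\in\mathbb{Z}\}$, let $L(2)=\{r\in L: r^2=2\}$, and let $\rho=(0;0,1)$ be the Leech cusp. Write $\mathrm{e}(x)=e^{2\pi i x}$. For $\operatorname{Re}(s)>25$ let $$E(z,s)=\sum_{r\in L(2)}\langle r,z\rangle^{-s},$$ with the branch of the power for which $(-x)^{-s}=\mathrm{e}(-s/2)\,x^{-s}$ for $x>0$. Let $h,k>0$ with $2h^2/k<1$, let $S_{k,h}=\{z\in V: z^2=-k,\ -\langle z,\rho\rangle=h\}$, parametrized by $$\phi:\mathbb{R}^{24}\to S_{k,h},\qquad \phi(v)=\Bigl(hv;\,h,\,\tfrac{k}{2h}+\tfrac{h v^2}{2}\Bigr),$$ and let $\operatorname{Re}(s)>25$.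 Then $S_{k,h}$ meets no hyperplane $r^\perp$ with $r\in L(2)$, the series $E(z,s)$ converges absolutely for every $z\in S_{k,h}$, and $v\mapsto E(\phi(v),s)$ is a $\Lambda$-periodic function which is integrable on the torus $\mathbb{R}^{24}/\Lambda$. For $\lambda\in\Lambda$ let $$a_\lambda(k,h,s)=\int_{\mathbb{R}^{24}/\Lambda}E(\phi(v),s)\,\mathrm{e}(-\langle\lambda,v\rangle)\,dv,\qquad a_\lambda^*(k,h,s)=\Bigl(\frac{h}{2\pi}\Bigr)^{s}\Gamma(s)\,a_\lambda(k,h,s)$$ be its Fourier coefficients and normalized Fourier coefficients. For $n\ge1$ put $$j_{\lambda,n}=\sum_{\substack{l\in\Lambda/n\Lambda\\ l^2/2\equiv1\bmod n}}\mathrm{e}\bigl(\langle l,\lambda\rangle/n\bigr),\qquad c_n=\sqrt{\frac{k}{h^2}-\frac{2}{n^2}},$$ and for $y>0$ let $K_\nu(y)=\frac12\int_0^\infty e^{-y(t+1/t)/2}\,t^{\nu}\,\frac{dt}{t}$ be the modified Bessel function. Then $$a_\lambda^*(k,h,s)=\begin{cases}\displaystyle 2\bigl(1+\mathrm{e}(-\tfrac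 s2)\bigr)|\lambda|^{s-12}\sum_{n\ge1}j_{\lambda,n}\,n^{-s}\,c_n^{12-s}\,K_{12-s}(2\pi|\lambda|c_n)&\text{if }\lambda\ne0,\\[2ex]\displaystyle \bigl(1+\mathrm{e}(-\tfrac s2)\bigr)\,\Gamma(s-12)\,\pi^{12-s}\sum_{n\ge1}j_{0,n}\,n^{-s}\,c_n^{24-2s}&\text{if }\lambda=0,\end{cases}$$ where the series on the right converge absolutely. -/

import Mathlib

noncomputable section

namespace LeechPoincare

open MeasureTheory

/-- Euclidean 24-space, the real span of the Leech lattice. -/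
abbrev E24 : Type := EuclideanSpace ℝ (Fin 24)

/-- A Leech lattice in Euclidean 24-space: an even self-dual lattice of full rank with no
vectors of norm (that is, squared length) 2. -/
structure IsLeechLattice (Λ : Submodule ℤ E24) : Prop where
  discrete : DiscreteTopology Λ
  span_top : Submodule.span ℝ (Λ : Set E24) = ⊤
  even : ∀ x ∈ Λ, ∃ m : ℤ, inner ℝ x x = 2 * (m : ℝ)
  self_dual : ∀ x : E24, x ∈ Λ ↔ ∀ y ∈ Λ, ∃ m : ℤ, inner ℝ x y = (m : ℝ)
  no_roots : ∀ x ∈ Λ, inner ℝ x x ≠ (2 : ℝ)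

/-- The Lorentzian space `V = L ⊗ ℝ`; its vectors are written `(l; m, n)`. -/
abbrev V : Type := E24 × ℝ × ℝ

/-- The bilinear form of signature `(25,1)` with `(l; m, n)² = l² - 2 m n`. -/
def form (x y : V) : ℝ := inner ℝ x.1 y.1 - x.2.1 * y.2.2 - x.2.2 * y.2.1

/-- The lattice `L = Λ ⊕ II_{1,1}` of all `(l; m, n)` with `l ∈ Λ` and `m, n ∈ ℤ`. -/
def latticeL (Λ : Submodule ℤ E24) : Submodule ℤ V :=
  Λ.prod ((LinearMap.range (Algebra.linearMap ℤ ℝ)).prod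
    (LinearMap.range (Algebra.linearMap ℤ ℝ)))

/-- The set `L(2)` of roots of `L`. -/
def roots (Λ : Submodule ℤ E24) : Set V := {r | r ∈ latticeL Λ ∧ form r r = 2}

/-- The Leech cusp `ρ = (0; 0, 1)`. -/
def cusp : V := (0, 0, 1)

/-- The height `ht(v) = -⟨v, ρ⟩`. -/
def ht (v : V) : ℝ := -form v cusp

/-- The orbit `S_{k,h}` of the real translation group. -/
def orbitS (k h : ℝ) : Set V := {v | form v v = -k ∧ ht v = h}

/-- The translation `T_v (l; a, b) = (l + a v; a, b + ⟨l, v⟩ + a v² / 2)`. -/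
def transl (v : E24) (x : V) : V :=
  (x.1 + x.2.1 • v, x.2.1, x.2.2 + inner ℝ x.1 v + x.2.1 * inner ℝ v v / 2)

/-- The parametrization `φ(v) = T_v (0; h, k / 2h)` of `S_{k,h}` by `Λ ⊗ ℝ`. -/
def phi (k h : ℝ) (v : E24) : V := transl v (0, h, k / (2 * h))

/-- `e(x) = exp(2 π i x)`. -/
def e (x : ℂ) : ℂ := Complex.exp (2 * Real.pi * Complex.I * x)

/-- The summand `⟨r, z⟩^{-s}`. The principal power satisfies `(-x)^{-s} = e(-s/2) x^{-s}` for
`x > 0`, which is the branch `(-1)^s = e(s/2)`. -/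
def term (s : ℂ) (z r : V) : ℂ := ((form r z : ℝ) : ℂ) ^ (-s)

/-- The Poincare series `E(z,s)`, the sum of `⟨r, z⟩^{-s}` over all roots `r` of `L`. -/
def poincareE (Λ : Submodule ℤ E24) (z : V) (s : ℂ) : ℂ := ∑' r : roots Λ, term s z r

/-- The Fourier coefficient `a_l(k,h,s)`: the integral of `E(φ(v),s) e(-⟨l, v⟩)` over the torus
`(Λ ⊗ ℝ) / Λ`, computed on a fundamental domain `F` of `Λ`. -/
def fourierA (Λ : Submodule ℤ E24) (F : Set E24) (l : E24) (k h : ℝ) (s : ℂ) : ℂ :=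
  ∫ v in F, poincareE Λ (phi k h v) s * e (-((inner ℝ l v : ℝ) : ℂ))

/-- The normalized coefficient `a*_l(k,h,s) = (h / 2π)^s Γ(s) a_l(k,h,s)`. -/
def fourierAStar (Λ : Submodule ℤ E24) (F : Set E24) (l : E24) (k h : ℝ) (s : ℂ) : ℂ :=
  ((h / (2 * Real.pi) : ℝ) : ℂ) ^ s * Complex.Gamma s * fourierA Λ F l k h s

/-- The subgroup `n Λ` of `Λ`. -/
def mulSub (Λ : Submodule ℤ E24) (n : ℕ) : Submodule ℤ Λ :=
  LinearMap.range ((n : ℤ) • (LinearMap.id : Λ →ₗ[ℤ] Λ))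

/-- The set `Λ_n(d)` of classes `l` in `Λ / n Λ` with `l² / 2 ≡ d mod n`. -/
def shell (Λ : Submodule ℤ E24) (n : ℕ) (d : ℤ) : Set (Λ ⧸ mulSub Λ n) :=
  {q | ∃ l : Λ, (mulSub Λ n).mkQ l = q ∧
    ∃ m : ℤ, inner ℝ (l : E24) (l : E24) / 2 = (d : ℝ) + (n : ℝ) * (m : ℝ)}

/-- The exponential sum `j_{l,n}`, the sum of `e(⟨x, l⟩ / n)` over `x ∈ Λ_n(1)`. The summand does
not depend on the representative of the class of `x` when `Λ` is integral and `l ∈ Λ`. -/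
def jSum (Λ : Submodule ℤ E24) (l : E24) (n : ℕ) : ℂ :=
  ∑ᶠ q : shell Λ n 1,
    e (((inner ℝ ((Quotient.out (q : Λ ⧸ mulSub Λ n) : Λ) : E24) l : ℝ) : ℂ) / (n : ℂ))

/-- The numbers `c_n = √(k / h² - 2 / n²)`. -/
def cNum (k h : ℝ) (n : ℕ) : ℝ := Real.sqrt (k / h ^ 2 - 2 / (n : ℝ) ^ 2)

/-- The modified (Macdonald) Bessel function
`K_ν(y) = (1/2) ∫_0^∞ exp(-y (t + 1/t) / 2) t^ν dt/t`, for `y > 0`. -/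
def besselK (ν : ℂ) (y : ℝ) : ℂ :=
  (1 / 2 : ℂ) * ∫ t in Set.Ioi (0 : ℝ),
    ((Real.exp (-y * (t + 1 / t) / 2) : ℝ) : ℂ) * (t : ℂ) ^ (ν - 1)

end LeechPoincare

end

open LeechPoincare MeasureTheory

/-! A root `(l; m, n)` with `m = 0` would give a vector of norm 2 in `Λ`, so `m ≠ 0`. Up to sign the
root is then `(x; -n, -(x²/2 - 1)/n)` with `n ≥ 1` and `x²/2 ≡ 1 mod n`. Completing the square, its
pairing with `φ(v)` is `(nh/2)(|v + x/n|² + c_n²)`. This is positive, so no mirror meets the orbit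
(`form_rootOf_phi`). Writing `x = rep + nμ` with `rep` fixed in its class mod `nΛ`, the shift `x/n`
becomes `rep/n + μ`. Hence `E ∘ φ` is a sum over signs and classes of full `Λ`-periodizations of
radial functions (`rootEquiv`, `term_rootParam`). Unfolding replaces the torus by `ℝ²⁴`
(`setIntegral_tsum_translates`). The shift by `rep/n` contributes the phases that add up to `j`, and
the two signs contribute `1 + e(-s/2)`. What remains is the Fourier transform of `(v² + c²)^{-s}`.
It is written as a Gamma integral of Gaussians, leaving a Bessel integral for nonzero frequency and
a Gamma integral at frequency zero. At most `n²⁴` classes occur for each `n`, whence `Re s > 25`.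
Tonelli gives convergence only almost everywhere; a comparison of the summands at two points extends
it to every point. -/

namespace LeechPoincare
open MeasureTheory

/-! ### Unfolding a periodization over a fundamental domain -/

section Unfolding

variable {Λ : Submodule ℤ E24} {F : Set E24} {ι : Type*}

instance lattice_vaddInvariantMeasure : VAddInvariantMeasure Λ E24 (volume : Measure E24) where
  measure_preimage_vadd c s _ := by
    simp [Submodule.vadd_def]

theorem integrable_translate {g : ι → E24 → ℂ} (hg : ∀ i, Integrable (g i))
    (p : ι × Λ) : Integrable (fun v => g p.1 (v + p.2)) (volume.restrict F) :=
  ((hg p.1).comp_add_right (p.2 : E24)).integrableOn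

variable [Countable Λ]

theorem tsum_setLIntegral_translates (hF : IsAddFundamentalDomain Λ F volume)
    {g : ι → E24 → ℂ} :
    ∑' p : ι × Λ, ∫⁻ v in F, ‖g p.1 (v + p.2)‖ₑ = ∑' i, ∫⁻ v, ‖g i v‖ₑ := by
  rw [ENNReal.tsum_prod']
  refine tsum_congr fun i => ?_
  rw [hF.lintegral_eq_tsum'']
  simp [Submodule.vadd_def, add_comm]

theorem tsum_setLIntegral_translates_ne_top (hF : IsAddFundamentalDomain Λ F volume)
    {g : ι → E24 → ℂ} (hg : ∀ i, Integrable (g i)) (hs : Summable fun i => ∫ v, ‖g i v‖) :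
    ∑' p : ι × Λ, ∫⁻ v in F, ‖g p.1 (v + p.2)‖ₑ ≠ ⊤ := by
  rw [tsum_setLIntegral_translates hF]
  simp_rw [fun i => ((ofReal_integral_norm_eq_lintegral_enorm (hg i)).symm)]
  exact hs.tsum_ofReal_ne_top

variable [Countable ι]

theorem lintegral_tsum_translates_ne_top (hF : IsAddFundamentalDomain Λ F volume)
    {g : ι → E24 → ℂ} (hg : ∀ i, Integrable (g i)) (hs : Summable fun i => ∫ v, ‖g i v‖) :
    ∫⁻ v in F, ∑' p : ι × Λ, ‖g p.1 (v + p.2)‖ₑ ≠ ⊤ := by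
  rw [lintegral_tsum fun p => (integrable_translate hg p).1.enorm]
  exact tsum_setLIntegral_translates_ne_top hF hg hs

/-- By Tonelli the sum of the norms has finite integral over `F`, hence is finite almost everywhere.
-/
theorem ae_summable_translates (hF : IsAddFundamentalDomain Λ F volume)
    {g : ι → E24 → ℂ} (hg : ∀ i, Integrable (g i)) (hs : Summable fun i => ∫ v, ‖g i v‖) :
    ∀ᵐ v ∂volume.restrict F, Summable fun p : ι × Λ => g p.1 (v + p.2) := by
  filter_upwards [ae_lt_top' (AEMeasurable.tsum
    fun p => (integrable_translate hg p).1.enorm)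
    (lintegral_tsum_translates_ne_top hF hg hs)] with v hv
  refine Summable.of_norm ?_
  simpa using ENNReal.summable_toReal hv.ne

/-- The translates of `F` tile the space, so for each `i` the integrals over `F` of all lattice
translates assemble into one integral over the whole space. Summability of the `L¹` norms allows the
interchange. -/
theorem setIntegral_tsum_translates (hF : IsAddFundamentalDomain Λ F volume)
    {g : ι → E24 → ℂ} (hg : ∀ i, Integrable (g i)) (hs : Summable fun i => ∫ v, ‖g i v‖) :
    ∫ v in F, ∑' p : ι × Λ, g p.1 (v + p.2) = ∑' i, ∫ v, g i v := by
  have hp := tsum_setLIntegral_translates_ne_top hF hg hs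
  have hsum : Summable fun p : ι × Λ => ∫ v in F, ‖g p.1 (v + p.2)‖ := by
    refine (ENNReal.summable_toReal hp).congr fun p => ?_
    exact (integral_norm_eq_lintegral_enorm (integrable_translate hg p).1).symm
  rw [← (hasSum_integral_of_summable_integral_norm (integrable_translate hg) hsum).tsum_eq,
    Summable.tsum_prod (hsum.of_norm_bounded fun p => norm_integral_le_integral_norm _)]
  refine tsum_congr fun i => ?_
  rw [hF.integral_eq_tsum'' _ (hg i)]
  simp [Submodule.vadd_def, add_comm]

theorem integrableOn_tsum_translates (hF : IsAddFundamentalDomain Λ F volume)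
    {g : ι → E24 → ℂ} (hg : ∀ i, Integrable (g i)) (hs : Summable fun i => ∫ v, ‖g i v‖) :
    IntegrableOn (fun v => ∑' p : ι × Λ, g p.1 (v + p.2)) F := by
  refine ⟨(AEMeasurable.tsum fun p => (integrable_translate hg p).1.aemeasurable
    ).aestronglyMeasurable, ?_⟩
  exact (lintegral_mono fun v => enorm_tsum_le_tsum_enorm).trans_lt
    (lintegral_tsum_translates_ne_top hF hg hs).lt_top

end Unfolding

/-! ### Fourier transform of the radial profile -/

section Profile

theorem cpow_eq_exp_log {y : ℝ} (hy : 0 < y) (w : ℂ) :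
    (y : ℂ) ^ w = Complex.exp (Real.log y * w) := by
  rw [Complex.cpow_def_of_ne_zero (by exact_mod_cast hy.ne'), Complex.ofReal_log hy.le]

/-- The radial function `v ↦ (v² + c²)^{-s}` on Euclidean 24-space. -/
noncomputable def profile (s : ℂ) (c : ℝ) (v : E24) : ℂ := ((‖v‖ ^ 2 + c ^ 2 : ℝ) : ℂ) ^ (-s)

variable {s : ℂ} {c : ℝ}

theorem norm_profile (hc : 0 < c) (v : E24) :
    ‖profile s c v‖ = (‖v‖ ^ 2 + c ^ 2) ^ (-s.re) := by
  rw [profile, Complex.norm_cpow_eq_rpow_re_of_pos (by positivity), Complex.neg_re]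

/-- The bound is uniform in `c ≥ c₁`; since `c_n ≥ c_1`, it serves all denominators `n` at once. -/
theorem norm_profile_le {c₁ : ℝ} (hs : 0 ≤ s.re) (h₁ : 0 < c₁) (hc : c₁ ≤ c) (v : E24) :
    ‖profile s c v‖ ≤ (min 1 (c₁ ^ 2)) ^ (-s.re) * (1 + ‖v‖ ^ 2) ^ (-s.re) := by
  have h0 : 0 < min 1 (c₁ ^ 2) := by positivity
  rw [norm_profile (h₁.trans_le hc), ← Real.mul_rpow h0.le (by positivity)]
  refine Real.rpow_le_rpow_of_nonpos (by positivity) ?_ (by linarith)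
  have h2 : c₁ ^ 2 ≤ c ^ 2 := by gcongr
  nlinarith [min_le_left 1 (c₁ ^ 2), min_le_right 1 (c₁ ^ 2), sq_nonneg ‖v‖]

theorem measurable_profile : Measurable (profile s c) := by
  unfold profile
  fun_prop

theorem integrable_one_add_norm_sq_rpow (hs : 12 < s.re) :
    Integrable (fun v : E24 => (1 + ‖v‖ ^ 2) ^ (-s.re)) := by
  have := integrable_rpow_neg_one_add_norm_sq (E := E24) (μ := volume) (r := 2 * s.re)
    (by simp; linarith)
  refine this.congr (.of_forall fun v => ?_)
  simp only
  congr 1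
  ring

theorem integrable_profile (hs : 12 < s.re) (hc : 0 < c) : Integrable (profile s c) :=
  ((integrable_one_add_norm_sq_rpow hs).const_mul _).mono' measurable_profile.aestronglyMeasurable
    (.of_forall (norm_profile_le (by linarith) hc le_rfl))

theorem norm_e (x : ℝ) : ‖e x‖ = 1 := by
  rw [e, show 2 * Real.pi * Complex.I * (x : ℂ) = ((2 * Real.pi * x : ℝ) : ℂ) * Complex.I by
    push_cast; ring]
  exact Complex.norm_exp_ofReal_mul_I _

theorem norm_e_neg (x : ℝ) : ‖e (-(x : ℂ))‖ = 1 := by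
  rw [← Complex.ofReal_neg, norm_e]

theorem e_add (x y : ℂ) : e (x + y) = e x * e y := by
  rw [e, e, e, mul_add, Complex.exp_add]

theorem e_intCast (m : ℤ) : e m = 1 := by
  rw [e, Complex.exp_eq_one_iff]
  exact ⟨m, by ring⟩

theorem e_zero : e 0 = 1 := by simp [e]

theorem measurable_e : Measurable e := by unfold e; fun_prop

theorem integrable_mul_e {f : E24 → ℂ} (hf : Integrable f) (l : E24) :
    Integrable fun v => f v * e (-((inner ℝ l v : ℝ) : ℂ)) := by
  refine hf.mul_bdd (c := 1) ?_ ?_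
  · exact (measurable_e.comp (by fun_prop)).aestronglyMeasurable
  · exact .of_forall fun v => (norm_e_neg _).le

/-- Justifies Fubini below: integrating the norm over `t` first gives `Γ(Re s)` times the norm of
the profile, integrable for `Re s > 24/2`. -/
theorem integrable_gamma_kernel (hs : 12 < s.re) (hc : 0 < c) (l : E24) :
    Integrable (fun p : E24 × ℝ => (p.2 : ℂ) ^ (s - 1) *
      Complex.exp (-((‖p.1‖ ^ 2 + c ^ 2 : ℝ) * p.2)) * e (-((inner ℝ l p.1 : ℝ) : ℂ)))
      ((volume : Measure E24).prod (volume.restrict (Set.Ioi 0))) := by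
  have hn : ∀ v : E24, ∀ t : ℝ, 0 < t → ‖(t : ℂ) ^ (s - 1) *
      Complex.exp (-((‖v‖ ^ 2 + c ^ 2 : ℝ) * t)) * e (-((inner ℝ l v : ℝ) : ℂ))‖
      = t ^ (s.re - 1) * Real.exp (-((‖v‖ ^ 2 + c ^ 2) * t)) := by
    intro v t ht
    rw [norm_mul, norm_mul, norm_e_neg, mul_one, Complex.norm_cpow_eq_rpow_re_of_pos ht,
      ← Complex.ofReal_mul, ← Complex.ofReal_neg, ← Complex.ofReal_exp, Complex.norm_real,
      Real.norm_of_nonneg (Real.exp_pos _).le]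
    simp
  have hmeas : Measurable (fun p : E24 × ℝ => (p.2 : ℂ) ^ (s - 1) *
      Complex.exp (-((‖p.1‖ ^ 2 + c ^ 2 : ℝ) * p.2)) * e (-((inner ℝ l p.1 : ℝ) : ℂ))) := by
    refine Measurable.mul (by fun_prop) (measurable_e.comp (by fun_prop))
  rw [integrable_prod_iff hmeas.aestronglyMeasurable]
  refine ⟨.of_forall fun v => ?_, ?_⟩
  · have hr : 0 < ‖v‖ ^ 2 + c ^ 2 := by positivity
    have h1 := integrableOn_rpow_mul_exp_neg_mul_rpow (s := s.re - 1) (p := 1) (by linarith)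
      one_pos hr
    refine Integrable.mono' h1 ?_ ?_
    · exact (hmeas.comp (by fun_prop : Measurable fun t : ℝ => (v, t))).aestronglyMeasurable
    · refine (ae_restrict_iff' measurableSet_Ioi).2 (.of_forall fun t ht => ?_)
      simp only
      rw [hn v t ht, Real.rpow_one]
      exact le_of_eq (by congr 2; ring)
  · refine ((integrable_profile hs hc).norm.mul_const (Real.Gamma s.re)).congr
      (.of_forall fun v => ?_)
    have hr : 0 < ‖v‖ ^ 2 + c ^ 2 := by positivity
    simp only
    rw [setIntegral_congr_fun measurableSet_Ioi (fun t ht => hn v t ht),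
      Real.integral_rpow_mul_exp_neg_mul_Ioi (by linarith) hr, norm_profile hc, one_div,
      Real.inv_rpow hr.le, Real.rpow_neg hr.le]

theorem gaussian_fourier {t : ℝ} (ht : 0 < t) (l : E24) :
    ∫ v : E24, Complex.exp (-(((‖v‖ ^ 2 + c ^ 2 : ℝ) : ℂ) * t)) * e (-((inner ℝ l v : ℝ) : ℂ)) =
      (Real.pi / t : ℂ) ^ 12 * ((Real.exp (-(c ^ 2 * t + Real.pi ^ 2 * ‖l‖ ^ 2 / t)) : ℝ) : ℂ) := by
  have h := GaussianFourier.integral_cexp_neg_mul_sq_norm_add (V := E24) (b := (t : ℂ))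
    (by simpa using ht) (-(2 * Real.pi * Complex.I)) l
  calc _ = ∫ v : E24, Complex.exp (-(c ^ 2 * t : ℝ)) * Complex.exp (-(t : ℂ) * ‖v‖ ^ 2 +
        -(2 * Real.pi * Complex.I) * (inner ℝ l v : ℝ)) := by
        refine integral_congr_ae (.of_forall fun v => ?_)
        simp only [e]
        rw [← Complex.exp_add, ← Complex.exp_add]
        congr 1
        push_cast
        ring
    _ = _ := by
        rw [integral_const_mul]
        erw [h]
        have h12 : ((Module.finrank ℝ E24 : ℕ) : ℂ) / 2 = ((12 : ℕ) : ℂ) := by simp; norm_num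
        rw [h12, Complex.cpow_natCast, mul_left_comm, Complex.ofReal_exp, ← Complex.exp_add]
        congr 2
        push_cast
        have : (t : ℂ) ≠ 0 := by exact_mod_cast ht.ne'
        field_simp
        rw [Complex.I_sq]
        ring

/-- Insert `Γ(s) r^{-s} = ∫ t^{s-1} e^{-rt} dt` with `r = v² + c²` and integrate over `v` first. The
Gaussian factor `(π/t)^{12}` lowers the exponent by 12. -/
theorem gamma_mul_fourier_profile (hs : 12 < s.re) (hc : 0 < c) (l : E24) :
    Complex.Gamma s * ∫ v, profile s c v * e (-((inner ℝ l v : ℝ) : ℂ)) =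
      (Real.pi : ℂ) ^ 12 * ∫ t in Set.Ioi (0 : ℝ), (t : ℂ) ^ (s - 12 - 1) *
        ((Real.exp (-(c ^ 2 * t + Real.pi ^ 2 * ‖l‖ ^ 2 / t)) : ℝ) : ℂ) := by
  have h1 : ∀ v : E24, ∫ t in Set.Ioi (0 : ℝ), (t : ℂ) ^ (s - 1) *
      Complex.exp (-((‖v‖ ^ 2 + c ^ 2 : ℝ) * t)) * e (-((inner ℝ l v : ℝ) : ℂ)) =
      Complex.Gamma s * (profile s c v * e (-((inner ℝ l v : ℝ) : ℂ))) := by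
    intro v
    have hr : 0 < ‖v‖ ^ 2 + c ^ 2 := by positivity
    rw [integral_mul_const, Complex.integral_cpow_mul_exp_neg_mul_Ioi (by linarith) hr, profile,
      one_div, ← Complex.ofReal_inv, Complex.ofReal_inv, Complex.inv_cpow, Complex.cpow_neg]
    · ring
    · rw [Complex.arg_ofReal_of_nonneg hr.le]
      exact Real.pi_pos.ne
  rw [← integral_const_mul]
  simp_rw [← h1]
  rw [integral_integral_swap (integrable_gamma_kernel hs hc l), ← integral_const_mul]
  refine setIntegral_congr_fun measurableSet_Ioi fun t ht => ?_
  have ht' : (t : ℂ) ≠ 0 := by exact_mod_cast (ne_of_gt ht)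
  simp_rw [mul_assoc]
  rw [integral_const_mul, gaussian_fourier ht, ← mul_assoc, ← mul_assoc]
  congr 1
  rw [show s - 12 - 1 = (s - 1) - ((12 : ℕ) : ℂ) by push_cast; ring, Complex.cpow_sub (s - 1) _ ht',
    Complex.cpow_natCast, div_pow]
  field_simp

theorem gamma_mul_integral_profile (hs : 12 < s.re) (hc : 0 < c) :
    Complex.Gamma s * ∫ v, profile s c v =
      (Real.pi : ℂ) ^ 12 * Complex.Gamma (s - 12) * (c : ℂ) ^ (24 - 2 * s) := by
  have h := gamma_mul_fourier_profile hs hc 0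
  have hc' : (c : ℂ) ≠ 0 := by exact_mod_cast hc.ne'
  have hc2 : 0 < c ^ 2 := by positivity
  have key := Complex.integral_cpow_mul_exp_neg_mul_Ioi (a := s - 12) (r := c ^ 2)
    (by simp; linarith) hc2
  simp only [inner_zero_left, Complex.ofReal_zero, neg_zero, e_zero, mul_one, norm_zero] at h
  rw [h, mul_assoc]
  congr 1
  have h2 : (1 / ((c ^ 2 : ℝ) : ℂ)) ^ (s - 12) = (c : ℂ) ^ (24 - 2 * s) := by
    rw [one_div, Complex.inv_cpow _ _ (by
      rw [Complex.arg_ofReal_of_nonneg hc2.le]; exact Real.pi_pos.ne), ← Complex.cpow_neg,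
      Complex.cpow_def_of_ne_zero (by exact_mod_cast hc2.ne'), Complex.cpow_def_of_ne_zero hc',
      ← Complex.ofReal_log hc2.le, ← Complex.ofReal_log hc.le, Real.log_pow]
    congr 1
    push_cast
    ring
  rw [← h2, mul_comm (Complex.Gamma _), ← key]
  refine setIntegral_congr_fun measurableSet_Ioi fun t ht => ?_
  simp

theorem integral_eq_besselK {ν : ℂ} {l : ℝ} (hl : 0 < l) (hc : 0 < c) :
    ∫ t in Set.Ioi (0 : ℝ), (t : ℂ) ^ (ν - 1) *
        ((Real.exp (-(c ^ 2 * t + Real.pi ^ 2 * l ^ 2 / t)) : ℝ) : ℂ) =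
      2 * (Real.pi * l : ℂ) ^ ν * (c : ℂ) ^ (-ν) * besselK (-ν) (2 * Real.pi * l * c) := by
  set g : ℝ → ℂ := fun t => (t : ℂ) ^ (ν - 1) *
    ((Real.exp (-(c ^ 2 * t + Real.pi ^ 2 * l ^ 2 / t)) : ℝ) : ℂ) with hg
  -- The substitution `t = (πl/c) x⁻¹` makes both exponential terms have coefficient `πlc`. The
  -- inversion turns `ν` into `-ν`.
  have hb : 0 < Real.pi * l / c := by positivity
  have h1 := integral_comp_mul_left_Ioi' g 0 hb
  rw [mul_zero] at h1
  rw [← h1, ← integral_comp_rpow_Ioi (fun x => g (Real.pi * l / c * x))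
    (p := -1) (by norm_num), besselK, ← integral_smul, ← mul_assoc, ← integral_const_mul]
  refine setIntegral_congr_fun measurableSet_Ioi fun x (hx : 0 < x) => ?_
  have hx' : (x : ℂ) ≠ 0 := by exact_mod_cast hx.ne'
  have hE : -(c ^ 2 * (Real.pi * l / c * x⁻¹) + Real.pi ^ 2 * l ^ 2 / (Real.pi * l / c * x⁻¹)) =
      -(2 * Real.pi * l * c) * (x + 1 / x) / 2 := by
    field_simp
    ring
  have hb' : ((Real.pi * l / c * x⁻¹ : ℝ) : ℂ) ^ (ν - 1) =
      (Real.pi * l : ℂ) ^ ν * (c : ℂ) ^ (-ν) * (x : ℂ) ^ (-ν - 1) *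
        ((Real.pi * l / c * x⁻¹ : ℝ) : ℂ)⁻¹ * (x : ℂ) := by
    have hpl : 0 < Real.pi * l := by positivity
    have hy : 0 < Real.pi * l / c * x⁻¹ := by positivity
    rw [Complex.cpow_sub _ _ (by exact_mod_cast hy.ne'), Complex.cpow_one,
      Complex.cpow_sub _ _ hx', Complex.cpow_one, ← Complex.ofReal_mul, cpow_eq_exp_log hy,
      cpow_eq_exp_log hpl, cpow_eq_exp_log hc, cpow_eq_exp_log hx,
      Real.log_mul hb.ne' (inv_pos.2 hx).ne', Real.log_div hpl.ne' hc.ne', Real.log_inv,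
      div_eq_mul_inv]
    have : ∀ A B C D : ℂ, A * B * (C / x) * D⁻¹ * x = A * B * C * D⁻¹ := by
      intro A B C D
      field_simp
    rw [this, ← Complex.exp_add, ← Complex.exp_add]
    congr 2
    push_cast
    ring
  simp only [hg, Real.rpow_neg_one]
  rw [hE, hb', show (-1 - 1 : ℝ) = ((-2 : ℤ) : ℝ) by norm_num, Real.rpow_intCast]
  simp only [Complex.real_smul]
  have hc' : (c : ℂ) ≠ 0 := by exact_mod_cast hc.ne'
  have hl' : (l : ℂ) ≠ 0 := by exact_mod_cast hl.ne'
  have hp' : (Real.pi : ℂ) ≠ 0 := by exact_mod_cast Real.pi_ne_zero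
  push_cast
  rw [abs_neg, abs_one, zpow_neg]
  field_simp
  norm_num

end Profile

/-! ### Parametrization of the roots -/

section Lattice

variable {Λ : Submodule ℤ E24}

theorem IsLeechLattice.exists_inner_eq (hΛ : IsLeechLattice Λ) {x y : E24} (hx : x ∈ Λ)
    (hy : y ∈ Λ) : ∃ m : ℤ, inner ℝ x y = (m : ℝ) :=
  (hΛ.self_dual x).1 hx y hy

theorem IsLeechLattice.countable (hΛ : IsLeechLattice Λ) : Countable Λ := by
  have := hΛ.discrete
  have : IsZLattice ℝ Λ := ⟨hΛ.span_top⟩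
  infer_instance

theorem IsLeechLattice.card_quotient (hΛ : IsLeechLattice Λ) (n : ℕ) :
    Nat.card (Λ ⧸ mulSub Λ n) = n ^ 24 := by
  have := hΛ.discrete
  have : IsZLattice ℝ Λ := ⟨hΛ.span_top⟩
  have h := AddSubgroup.index_range_nsmul Λ n
  rw [ZLattice.rank ℝ Λ, finrank_euclideanSpace_fin] at h
  rw [← h]
  have : (mulSub Λ n).toAddSubgroup = (nsmulAddMonoidHom (α := Λ) n).range := by
    ext x
    simp [mulSub]
  rw [← this]
  rfl

theorem IsLeechLattice.finite_quotient (hΛ : IsLeechLattice Λ) (n : ℕ+) :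
    Finite (Λ ⧸ mulSub Λ n) :=
  Nat.finite_of_card_ne_zero (by rw [hΛ.card_quotient]; positivity)

theorem IsLeechLattice.card_shell_le (hΛ : IsLeechLattice Λ) (n : ℕ+) (d : ℤ) :
    Nat.card (shell Λ n d) ≤ (n : ℕ) ^ 24 := by
  have := hΛ.finite_quotient n
  rw [← hΛ.card_quotient n]
  exact Nat.card_le_card_of_injective _ Subtype.val_injective

theorem mem_mulSub {n : ℕ} {x : Λ} : x ∈ mulSub Λ n ↔ ∃ y : Λ, (n : ℤ) • y = x := by
  simp [mulSub]

/-- `(y + nw)²/2 = y²/2 + n⟨y, w⟩ + n²w²/2`, and `w²/2` is an integer by evenness. Thus every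
representative of a shell class satisfies the congruence. -/
theorem IsLeechLattice.half_norm_congr (hΛ : IsLeechLattice Λ) {n : ℕ} {x y : Λ} {d : ℤ}
    (hxy : (mulSub Λ n).mkQ x = (mulSub Λ n).mkQ y)
    (hy : ∃ m : ℤ, inner ℝ (y : E24) (y : E24) / 2 = (d : ℝ) + (n : ℝ) * (m : ℝ)) :
    ∃ m : ℤ, inner ℝ (x : E24) (x : E24) / 2 = (d : ℝ) + (n : ℝ) * (m : ℝ) := by
  obtain ⟨m, hm⟩ := hy
  obtain ⟨w, hw⟩ := mem_mulSub.1 ((Submodule.Quotient.eq _).1 hxy)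
  obtain ⟨a, ha⟩ := hΛ.exists_inner_eq y.2 w.2
  obtain ⟨b, hb⟩ := hΛ.even w w.2
  have hx : (x : E24) = y + (n : ℝ) • (w : E24) := by
    have := congrArg (Subtype.val) hw
    push_cast at this
    rw [← sub_eq_iff_eq_add', ← this, natCast_zsmul, Nat.cast_smul_eq_nsmul]
  refine ⟨m + a + n * b, ?_⟩
  rw [hx, inner_add_left, inner_add_right, inner_add_right, real_inner_smul_left,
    real_inner_smul_left, real_inner_smul_right, real_inner_smul_right,
    real_inner_comm (y : E24) (w : E24), ha, hb]
  push_cast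
  linarith

/-- The index set of pairs `(n, q)` with `q` a class in `Λ / n Λ` of half-norm `1` modulo `n`. -/
abbrev ShellIndex (Λ : Submodule ℤ E24) : Type := Σ n : ℕ+, shell Λ n 1

/-- A representative of the class of an index. -/
noncomputable def ShellIndex.rep (i : ShellIndex Λ) : Λ :=
  Quotient.out (i.2 : Λ ⧸ mulSub Λ i.1)

theorem ShellIndex.mkQ_rep (i : ShellIndex Λ) : (mulSub Λ i.1).mkQ i.rep = i.2 :=
  Quotient.out_eq _

/-- The vector `(x; -n, -(x² / 2 - 1) / n)` of norm `2`. -/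
noncomputable def rootOf (n : ℕ+) (x : E24) : V :=
  (x, -(n : ℝ), -((inner ℝ x x / 2 - 1) / n))

/-- The sign attached to a Boolean. -/
def boolSign (b : Bool) : ℝ := if b then 1 else -1

theorem form_smul_left (a : ℝ) (x y : V) : form (a • x) y = a * form x y := by
  simp only [form, Prod.smul_fst, Prod.smul_snd, real_inner_smul_left, smul_eq_mul]
  ring

theorem form_smul_smul (a : ℝ) (x : V) : form (a • x) (a • x) = a ^ 2 * form x x := by
  simp only [form, Prod.smul_fst, Prod.smul_snd, real_inner_smul_left, real_inner_smul_right,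
    smul_eq_mul]
  ring

theorem form_rootOf_self (n : ℕ+) (x : E24) : form (rootOf n x) (rootOf n x) = 2 := by
  have : (n : ℝ) ≠ 0 := by positivity
  simp only [form, rootOf]
  field_simp
  ring

theorem form_rootOf_phi {k h : ℝ} (hh : 0 < h) (n : ℕ+) (x v : E24) :
    form (rootOf n x) (phi k h v) =
      n * h / 2 * (‖v + (1 / (n : ℝ)) • x‖ ^ 2 + (k / h ^ 2 - 2 / (n : ℝ) ^ 2)) := by
  have : (n : ℝ) ≠ 0 := by positivity
  rw [← real_inner_self_eq_norm_sq]
  simp only [form, rootOf, phi, transl, zero_add, inner_add_left, inner_add_right,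
    real_inner_smul_left, real_inner_smul_right, inner_zero_left, real_inner_comm v x]
  field_simp
  ring

theorem boolSign_sq (b : Bool) : boolSign b ^ 2 = 1 := by
  cases b <;> simp [boolSign]

theorem boolSign_ne_zero (b : Bool) : boolSign b ≠ 0 := by
  cases b <;> simp [boolSign]

theorem boolSign_smul_mem_latticeL (b : Bool) {x : V} (hx : x ∈ latticeL Λ) :
    boolSign b • x ∈ latticeL Λ := by
  cases b <;> simp [boolSign, hx]

/-- The congruence on `x²/2` is exactly integrality of the last coordinate. -/
theorem rootOf_mem_roots {n : ℕ+} {x : Λ} (b : Bool)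
    (hx : ∃ m : ℤ, inner ℝ (x : E24) (x : E24) / 2 = ((1 : ℤ) : ℝ) + (n : ℝ) * (m : ℝ)) :
    boolSign b • rootOf n x ∈ roots Λ := by
  obtain ⟨m, hm⟩ := hx
  have : (n : ℝ) ≠ 0 := by positivity
  refine ⟨boolSign_smul_mem_latticeL b ⟨x.2, ⟨-(n : ℤ), by simp [rootOf]⟩, ⟨-m, ?_⟩⟩, ?_⟩
  · simp only [rootOf, hm]
    simp
  · rw [form_smul_smul, boolSign_sq, form_rootOf_self, one_mul]

/-- The lattice vector `x + n μ`, with `x` the representative of the class of the index. -/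
noncomputable def ShellIndex.vec (i : ShellIndex Λ) (μ : Λ) : Λ := i.rep + ((i.1 : ℕ) : ℤ) • μ

theorem ShellIndex.coe_vec (i : ShellIndex Λ) (μ : Λ) :
    (i.vec μ : E24) = i.rep + (i.1 : ℝ) • (μ : E24) := by
  rw [vec]
  push_cast
  rw [natCast_zsmul, Nat.cast_smul_eq_nsmul]

theorem ShellIndex.mkQ_vec (i : ShellIndex Λ) (μ : Λ) : (mulSub Λ i.1).mkQ (i.vec μ) = i.2 := by
  rw [vec, map_add, i.mkQ_rep, add_eq_left]
  exact (Submodule.Quotient.mk_eq_zero _).2 (mem_mulSub.2 ⟨μ, rfl⟩)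

theorem ShellIndex.half_norm_vec (hΛ : IsLeechLattice Λ) (i : ShellIndex Λ) (μ : Λ) :
    ∃ m : ℤ, inner ℝ (i.vec μ : E24) (i.vec μ : E24) / 2 =
      ((1 : ℤ) : ℝ) + ((i.1 : ℕ) : ℝ) * (m : ℝ) := by
  obtain ⟨l, hl, hm⟩ := i.2.2
  exact hΛ.half_norm_congr ((i.mkQ_vec μ).trans hl.symm) hm

theorem ShellIndex.exists_vec_eq {n : ℕ+} {x : Λ}
    (hx : ∃ m : ℤ, inner ℝ (x : E24) (x : E24) / 2 = ((1 : ℤ) : ℝ) + ((n : ℕ) : ℝ) * (m : ℝ)) :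
    ∃ (i : ShellIndex Λ) (μ : Λ), i.1 = n ∧ i.vec μ = x := by
  set i : ShellIndex Λ := ⟨n, (mulSub Λ n).mkQ x, x, rfl, hx⟩ with hi
  obtain ⟨μ, hμ⟩ := mem_mulSub.1 ((Submodule.Quotient.eq _).1 i.mkQ_rep.symm)
  exact ⟨i, μ, rfl, by rw [vec, hμ]; abel⟩

/-- The parametrization of the roots of `L` by signs, classes and lattice vectors. -/
noncomputable def rootParam (hΛ : IsLeechLattice Λ) (p : (Bool × ShellIndex Λ) × Λ) : roots Λ :=
  ⟨boolSign p.1.1 • rootOf p.1.2.1 (p.1.2.vec p.2), rootOf_mem_roots _ (p.1.2.half_norm_vec hΛ p.2)⟩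

theorem rootParam_injective (hΛ : IsLeechLattice Λ) : Function.Injective (rootParam hΛ) := by
  rintro ⟨⟨b, i⟩, μ⟩ ⟨⟨b', i'⟩, μ'⟩ h
  have h := congrArg Subtype.val h
  simp only [rootParam, rootOf, Prod.smul_mk, Prod.mk.injEq, smul_eq_mul] at h
  obtain ⟨h1, h2, -⟩ := h
  have hp : (0 : ℝ) < i.1 := by positivity
  have hp' : (0 : ℝ) < i'.1 := by positivity
  obtain rfl : b = b' := by
    cases b <;> cases b' <;> simp [boolSign] at h2 ⊢
  have h1 := smul_right_injective _ (boolSign_ne_zero b) h1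
  have hn : i.1 = i'.1 := by
    have := mul_left_cancel₀ (boolSign_ne_zero b) h2
    have := neg_injective this
    exact_mod_cast this
  obtain ⟨n, q⟩ := i
  obtain ⟨n', q'⟩ := i'
  obtain rfl : n = n' := hn
  have h1 : ShellIndex.vec ⟨n, q⟩ μ = ShellIndex.vec ⟨n, q'⟩ μ' := Subtype.ext h1
  obtain rfl : q = q' := by
    refine Subtype.ext ?_
    rw [← ShellIndex.mkQ_vec ⟨n, q⟩ μ, h1, ShellIndex.mkQ_vec ⟨n, q'⟩ μ']
  have h3 := congrArg Subtype.val h1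
  rw [ShellIndex.coe_vec, ShellIndex.coe_vec] at h3
  rw [Subtype.ext (smul_right_injective E24 hp.ne' (add_left_cancel h3))]

theorem rootParam_surjective (hΛ : IsLeechLattice Λ) : Function.Surjective (rootParam hΛ) := by
  rintro ⟨⟨x, m, j⟩, ⟨hx, ⟨M, hm⟩, ⟨J, hj⟩⟩, hr⟩
  change x ∈ Λ at hx
  obtain rfl : (M : ℝ) = m := hm
  obtain rfl : (J : ℝ) = j := hj
  simp only [form] at hr
  -- The absence of norm 2 vectors in `Λ` enters only here.
  have hM : M ≠ 0 := by
    rintro rfl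
    exact hΛ.no_roots x hx (by simpa using hr)
  have key : ∀ (b : Bool) (n : ℕ+), boolSign b * (-(n : ℝ)) = M →
      ∃ p, rootParam hΛ p = ⟨(x, (M : ℝ), (J : ℝ)), ⟨hx, ⟨M, rfl⟩, ⟨J, rfl⟩⟩, hr⟩ := by
    intro b n hb
    have hn : (n : ℝ) ≠ 0 := by positivity
    obtain ⟨y, hy⟩ : ∃ y : Λ, boolSign b • (y : E24) = x := by
      cases b
      · exact ⟨-⟨x, hx⟩, by simp [boolSign]⟩
      · exact ⟨⟨x, hx⟩, by simp [boolSign]⟩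
    obtain ⟨J', hJ⟩ : ∃ J' : ℤ, (J' : ℝ) = - boolSign b * J := by
      cases b
      · exact ⟨J, by simp [boolSign]⟩
      · exact ⟨-J, by simp [boolSign]⟩
    have hin : inner ℝ (y : E24) (y : E24) / 2 = ((1 : ℤ) : ℝ) + ((n : ℕ) : ℝ) * (J' : ℝ) := by
      rw [← hy, real_inner_smul_left, real_inner_smul_right, ← mul_assoc, ← sq, boolSign_sq,
        ← hb] at hr
      rw [hJ]
      push_cast
      linarith
    obtain ⟨i, μ, rfl, rfl⟩ := ShellIndex.exists_vec_eq ⟨J', hin⟩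
    refine ⟨((b, i), μ), Subtype.ext ?_⟩
    simp only [rootParam, rootOf, Prod.smul_mk, smul_eq_mul, Prod.mk.injEq]
    refine ⟨hy, hb, ?_⟩
    rw [hin, hJ]
    push_cast
    field_simp
    linear_combination (i.1 : ℝ) * (J : ℝ) * boolSign_sq b
  -- `rootOf` carries `-n` in the middle, so a negative `M` goes with the sign `+1`.
  rcases lt_or_gt_of_ne hM with h | h
  · obtain ⟨n, rfl⟩ : ∃ n : ℕ, M = -n := ⟨(-M).toNat, by omega⟩
    exact key true ⟨n, by omega⟩ (by simp [boolSign])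
  · obtain ⟨n, rfl⟩ : ∃ n : ℕ, M = n := ⟨M.toNat, by omega⟩
    exact key false ⟨n, by omega⟩ (by simp [boolSign])

/-- The parametrization of the roots as an equivalence. -/
noncomputable def rootEquiv (hΛ : IsLeechLattice Λ) : (Bool × ShellIndex Λ) × Λ ≃ roots Λ :=
  Equiv.ofBijective (rootParam hΛ) ⟨rootParam_injective hΛ, rootParam_surjective hΛ⟩

end Lattice

/-! ### Convergence and Fourier expansion -/

section Expansion

variable {Λ : Submodule ℤ E24} {F : Set E24} {k h : ℝ} {s : ℂ}

theorem cNum_radicand_pos (hh : 0 < h) (hk : 0 < k) (hkh : 2 * h ^ 2 / k < 1) (n : ℕ+) :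
    0 < k / h ^ 2 - 2 / (n : ℝ) ^ 2 := by
  have hn : (1 : ℝ) ≤ n := by exact_mod_cast one_le
  have h1 : 2 < k / h ^ 2 := by
    rw [div_lt_one hk] at hkh
    rwa [lt_div_iff₀ (by positivity)]
  have h2 : 2 / (n : ℝ) ^ 2 ≤ 2 := div_le_self (by norm_num) (one_le_pow₀ hn)
  linarith

theorem cNum_sq (hh : 0 < h) (hk : 0 < k) (hkh : 2 * h ^ 2 / k < 1) (n : ℕ+) :
    cNum k h n ^ 2 = k / h ^ 2 - 2 / (n : ℝ) ^ 2 :=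
  Real.sq_sqrt (cNum_radicand_pos hh hk hkh n).le

theorem cNum_pos (hh : 0 < h) (hk : 0 < k) (hkh : 2 * h ^ 2 / k < 1) (n : ℕ+) :
    0 < cNum k h n :=
  Real.sqrt_pos.2 (cNum_radicand_pos hh hk hkh n)

theorem cNum_one_le (n : ℕ+) : cNum k h (1 : ℕ+) ≤ cNum k h n := by
  have hn : (1 : ℝ) ≤ n := by exact_mod_cast one_le
  refine Real.sqrt_le_sqrt ?_
  have h2 : 2 / (n : ℝ) ^ 2 ≤ 2 := div_le_self (by norm_num) (one_le_pow₀ hn)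
  simp
  linarith

/-- The phase `1` or `e(-s/2)` of the power `(±x)^{-s}` for `x > 0`. -/
noncomputable def boolPhase (s : ℂ) (b : Bool) : ℂ := if b then 1 else e (-s / 2)

theorem cpow_boolSign_mul {x : ℝ} (hx : 0 < x) (b : Bool) :
    ((boolSign b * x : ℝ) : ℂ) ^ (-s) = boolPhase s b * (x : ℂ) ^ (-s) := by
  cases b
  · have hx' : (x : ℂ) ≠ 0 := by exact_mod_cast hx.ne'
    have : Complex.log ((-x : ℝ) : ℂ) = Complex.log x + Real.pi * Complex.I := by
      rw [Complex.log, Complex.log, Complex.arg_ofReal_of_neg (by linarith),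
        Complex.arg_ofReal_of_nonneg hx.le]
      simp
    simp only [boolSign, boolPhase, Bool.false_eq_true, if_false, neg_mul, one_mul, e]
    rw [Complex.cpow_def_of_ne_zero (by exact_mod_cast (neg_neg_of_pos hx).ne),
      Complex.cpow_def_of_ne_zero hx', this, ← Complex.exp_add]
    congr 1
    ring
  · simp [boolSign, boolPhase]

/-- The summand of the Poincaré series as a function on Euclidean 24-space, up to translation
by the lattice. -/
noncomputable def summand (k h : ℝ) (s : ℂ) (p : Bool × ShellIndex Λ) (v : E24) : ℂ :=
  boolPhase s p.1 * ((p.2.1 * h / 2 : ℝ) : ℂ) ^ (-s) *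
    profile s (cNum k h p.2.1) (v + (1 / (p.2.1 : ℝ)) • (p.2.rep : E24))

/-- Dividing `rep + nμ` by `n` turns `nμ` into the lattice translation `μ`, independent of `n`; this
makes unfolding possible. -/
theorem form_rootParam_phi (hΛ : IsLeechLattice Λ) (hh : 0 < h) (hk : 0 < k)
    (hkh : 2 * h ^ 2 / k < 1) (p : (Bool × ShellIndex Λ) × Λ) (v : E24) :
    form (rootParam hΛ p) (phi k h v) = boolSign p.1.1 * (p.1.2.1 * h / 2 *
      (‖v + p.2 + (1 / (p.1.2.1 : ℝ)) • (p.1.2.rep : E24)‖ ^ 2 + cNum k h p.1.2.1 ^ 2)) := by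
  have hn : (p.1.2.1 : ℝ) ≠ 0 := by positivity
  rw [rootParam, form_smul_left, form_rootOf_phi hh, cNum_sq hh hk hkh, ShellIndex.coe_vec,
    smul_add, smul_smul, one_div_mul_cancel hn, one_smul, add_assoc v, add_comm (p.2 : E24)]

theorem term_rootParam (hΛ : IsLeechLattice Λ) (hh : 0 < h) (hk : 0 < k)
    (hkh : 2 * h ^ 2 / k < 1) (p : (Bool × ShellIndex Λ) × Λ) (v : E24) :
    term s (phi k h v) (rootParam hΛ p) = summand k h s p.1 (v + p.2) := by
  have hc := cNum_pos hh hk hkh p.1.2.1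
  have hn : (0 : ℝ) < p.1.2.1 * h / 2 := by positivity
  rw [term, form_rootParam_phi hΛ hh hk hkh, cpow_boolSign_mul (by positivity), summand, profile,
    Complex.ofReal_mul, Complex.mul_cpow_ofReal_nonneg hn.le (by positivity), mul_assoc]

theorem poincareE_phi (hΛ : IsLeechLattice Λ) (hh : 0 < h) (hk : 0 < k)
    (hkh : 2 * h ^ 2 / k < 1) (v : E24) :
    poincareE Λ (phi k h v) s =
      ∑' p : (Bool × ShellIndex Λ) × Λ, summand k h s p.1 (v + p.2) := by
  rw [poincareE, ← (rootEquiv hΛ).tsum_eq]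
  exact tsum_congr fun p => term_rootParam hΛ hh hk hkh p v

theorem poincareE_phi_add (hΛ : IsLeechLattice Λ) (hh : 0 < h) (hk : 0 < k)
    (hkh : 2 * h ^ 2 / k < 1) {μ : E24} (hμ : μ ∈ Λ) (v : E24) :
    poincareE Λ (phi k h (v + μ)) s = poincareE Λ (phi k h v) s := by
  rw [poincareE_phi hΛ hh hk hkh, poincareE_phi hΛ hh hk hkh,
    ← ((Equiv.refl _).prodCongr (Equiv.addLeft (⟨μ, hμ⟩ : Λ))).tsum_eq
      (fun p : (Bool × ShellIndex Λ) × Λ => summand k h s p.1 (v + p.2))]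
  refine tsum_congr fun p => ?_
  simp [add_assoc]

theorem integrable_summand (hh : 0 < h) (hk : 0 < k) (hkh : 2 * h ^ 2 / k < 1) (hs : 12 < s.re)
    (p : Bool × ShellIndex Λ) : Integrable (summand k h s p) :=
  ((integrable_profile hs (cNum_pos hh hk hkh _)).comp_add_right _).const_mul _

theorem summable_shellIndex (hΛ : IsLeechLattice Λ) {σ : ℝ} (hσ : 25 < σ) :
    Summable fun i : ShellIndex Λ => (i.1 : ℝ) ^ (-σ) := by
  have := fun n : ℕ+ => hΛ.finite_quotient n
  rw [summable_sigma_of_nonneg fun i => by positivity]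
  refine ⟨fun n => Summable.of_finite, ?_⟩
  have hsum : Summable fun n : ℕ+ => ((n : ℕ) : ℝ) ^ (24 - σ) :=
    (Real.summable_nat_rpow.2 (by linarith : 24 - σ < -1)).comp_injective PNat.coe_injective
  refine hsum.of_nonneg_of_le (fun n => tsum_nonneg fun _ => by positivity) fun n => ?_
  have hn : (0 : ℝ) < n := by positivity
  change ∑' _ : shell Λ n 1, ((n : ℕ) : ℝ) ^ (-σ) ≤ _
  rw [tsum_const, nsmul_eq_mul, sub_eq_add_neg, Real.rpow_add hn]
  have := hΛ.card_shell_le n 1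
  gcongr
  exact_mod_cast this

/-- Translation invariance removes `rep/n`, and the bound at `c_1` controls every profile. Only
`n^{-Re s}` summed over the classes remains. -/
theorem summable_integral_norm_summand (hΛ : IsLeechLattice Λ) (hh : 0 < h) (hk : 0 < k)
    (hkh : 2 * h ^ 2 / k < 1) (hs : 25 < s.re) :
    Summable fun p : Bool × ShellIndex Λ => ∫ v, ‖summand k h s p v‖ := by
  set D : ℝ := (min 1 (cNum k h (1 : ℕ+) ^ 2)) ^ (-s.re) * ∫ v : E24, (1 + ‖v‖ ^ 2) ^ (-s.re)
  have hsum : Summable fun p : Bool × ShellIndex Λ =>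
      ‖boolPhase s p.1‖ * ((p.2.1 : ℝ) ^ (-s.re) * ((h / 2) ^ (-s.re) * D)) :=
    Summable.mul_of_nonneg (f := fun b => ‖boolPhase s b‖)
      (g := fun i : ShellIndex Λ => (i.1 : ℝ) ^ (-s.re) * ((h / 2) ^ (-s.re) * D))
      Summable.of_finite ((summable_shellIndex hΛ hs).mul_right _) (fun _ => norm_nonneg _)
      (fun i => by
        have : 0 ≤ D := mul_nonneg (by positivity) (integral_nonneg fun v => by positivity)
        positivity)
  refine hsum.of_nonneg_of_le (fun p => integral_nonneg fun v => norm_nonneg _) fun p => ?_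
  simp only [summand, norm_mul]
  rw [integral_const_mul, integral_add_right_eq_self (fun v => ‖profile s (cNum k h p.2.1) v‖),
    Complex.norm_cpow_eq_rpow_re_of_pos (by positivity), mul_assoc, mul_div_assoc, Complex.neg_re,
    Real.mul_rpow (by positivity) (by positivity), mul_assoc ((p.2.1 : ℝ) ^ (-s.re))]
  gcongr
  refine le_of_le_of_eq ?_ (integral_const_mul _ _)
  exact integral_mono (integrable_profile (by linarith) (cNum_pos hh hk hkh _)).norm
    ((integrable_one_add_norm_sq_rpow (by linarith)).const_mul _)
    (norm_profile_le (by linarith) (cNum_pos hh hk hkh 1) (cNum_one_le _))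

/-- The ratio of two values is bounded in terms of `v - w` and `c₁` only, so convergence at one
point implies convergence at all points. -/
theorem norm_profile_le_translate {c₁ c : ℝ} (hs : 0 ≤ s.re) (h₁ : 0 < c₁) (hc : c₁ ≤ c)
    (v w : E24) : ‖profile s c w‖ ≤
      (2 + 2 * ‖v - w‖ ^ 2 / c₁ ^ 2) ^ s.re * ‖profile s c v‖ := by
  have hc0 := h₁.trans_le hc
  set K := 2 + 2 * ‖v - w‖ ^ 2 / c₁ ^ 2
  have hK : 0 < K := by positivity
  have key : (‖v‖ ^ 2 + c ^ 2) / K ≤ ‖w‖ ^ 2 + c ^ 2 := by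
    rw [div_le_iff₀ hK]
    have h2 : ‖v‖ ≤ ‖w‖ + ‖v - w‖ := by
      simpa using norm_add_le w (v - w)
    have h3 : ‖v‖ ^ 2 ≤ 2 * ‖w‖ ^ 2 + 2 * ‖v - w‖ ^ 2 := by
      nlinarith [norm_nonneg v, norm_nonneg w, norm_nonneg (v - w),
        sq_nonneg (‖w‖ - ‖v - w‖)]
    have h4 : 2 * ‖v - w‖ ^ 2 ≤ 2 * ‖v - w‖ ^ 2 / c₁ ^ 2 * c ^ 2 := by
      rw [div_mul_eq_mul_div, le_div_iff₀ (by positivity)]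
      gcongr
    have h5 : 0 ≤ 2 * ‖v - w‖ ^ 2 / c₁ ^ 2 * ‖w‖ ^ 2 := by positivity
    simp only [K]
    nlinarith [sq_nonneg c]
  rw [norm_profile hc0, norm_profile hc0]
  refine (Real.rpow_le_rpow_of_nonpos (by positivity) key (by linarith)).trans_eq ?_
  rw [Real.div_rpow (by positivity) hK.le, Real.rpow_neg hK.le, div_inv_eq_mul, mul_comm]

theorem summable_summand (hΛ : IsLeechLattice Λ) (hF : IsAddFundamentalDomain Λ F volume)
    (hh : 0 < h) (hk : 0 < k) (hkh : 2 * h ^ 2 / k < 1) (hs : 25 < s.re) (v : E24) :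
    Summable fun p : (Bool × ShellIndex Λ) × Λ => summand k h s p.1 (v + p.2) := by
  have := hΛ.countable
  have := fun n : ℕ+ => hΛ.finite_quotient n
  have hae := ae_summable_translates hF
    (integrable_summand (Λ := Λ) hh hk hkh (by linarith : 12 < s.re))
    (summable_integral_norm_summand hΛ hh hk hkh hs)
  -- A fundamental domain is not null, so some point `w` of convergence exists.
  have hF0 : volume.restrict F ≠ 0 := by
    rw [Ne, Measure.restrict_eq_zero]
    exact hF.measure_ne_zero (NeZero.ne _)
  have : (ae (volume.restrict F)).NeBot := ae_neBot.2 hF0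
  obtain ⟨w, hw⟩ := hae.exists
  refine Summable.of_norm_bounded
    (hw.norm.mul_left ((2 + 2 * ‖w - v‖ ^ 2 / cNum k h (1 : ℕ+) ^ 2) ^ s.re)) fun p => ?_
  simp only [summand, norm_mul]
  rw [mul_left_comm]
  gcongr
  have := norm_profile_le_translate (s := s) (by linarith) (cNum_pos hh hk hkh 1)
    (cNum_one_le p.1.2.1) (w + p.2 + (1 / (p.1.2.1 : ℝ)) • (p.1.2.rep : E24))
    (v + p.2 + (1 / (p.1.2.1 : ℝ)) • (p.1.2.rep : E24))
  rwa [add_sub_add_right_eq_sub, add_sub_add_right_eq_sub] at this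

theorem exists_phi_eq (hh : 0 < h) {z : V} (hz : z ∈ orbitS k h) : ∃ v, phi k h v = z := by
  obtain ⟨x, a, b⟩ := z
  obtain ⟨h1, h2⟩ := hz
  simp only [ht, form, cusp, inner_zero_right] at h1 h2
  obtain rfl : a = h := by linarith
  refine ⟨a⁻¹ • x, ?_⟩
  simp only [phi, transl, smul_smul, real_inner_smul_left, real_inner_smul_right, inner_zero_left,
    mul_inv_cancel₀ hh.ne', one_smul, zero_add, add_zero, Prod.mk.injEq, true_and]
  field_simp
  linarith

/-- Shifting the variable by `rep/n` moves the class into the phase `e(⟨rep, l⟩/n)`. -/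
theorem integral_summand_mul_e (p : Bool × ShellIndex Λ) (l : E24) :
    ∫ v, summand k h s p v * e (-((inner ℝ l v : ℝ) : ℂ)) =
      boolPhase s p.1 * (((p.2.1 * h / 2 : ℝ) : ℂ) ^ (-s) *
        (∫ v, profile s (cNum k h p.2.1) v * e (-((inner ℝ l v : ℝ) : ℂ))) *
          e (((inner ℝ (p.2.rep : E24) l : ℝ) : ℂ) / (p.2.1 : ℂ))) := by
  rw [← integral_add_right_eq_self (fun v => profile s (cNum k h p.2.1) v *
    e (-((inner ℝ l v : ℝ) : ℂ))) ((1 / (p.2.1 : ℝ)) • (p.2.rep : E24)),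
    mul_assoc, ← mul_assoc, ← integral_mul_const, ← integral_const_mul]
  refine integral_congr_ae (.of_forall fun v => ?_)
  simp only [summand]
  rw [mul_assoc (boolPhase s p.1 * _), mul_assoc (profile _ _ _), ← e_add, inner_add_right,
    real_inner_smul_right, real_inner_comm (p.2.rep : E24) l]
  congr 3
  push_cast
  ring

theorem hasSum_jSum (hΛ : IsLeechLattice Λ) (l : E24) (n : ℕ+) :
    HasSum (fun q : shell Λ n 1 =>
      e (((inner ℝ (ShellIndex.rep ⟨n, q⟩ : E24) l : ℝ) : ℂ) / (n : ℂ))) (jSum Λ l n) := by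
  have := hΛ.finite_quotient n
  have h : HasSum (fun q : shell Λ n 1 =>
      e (((inner ℝ (ShellIndex.rep ⟨n, q⟩ : E24) l : ℝ) : ℂ) / (n : ℂ))) _ :=
    Summable.of_finite.hasSum
  rwa [tsum_eq_finsum (Set.toFinite _)] at h

theorem e_neg_inner_add (hΛ : IsLeechLattice Λ) {l : E24} (hl : l ∈ Λ) (v : E24) (μ : Λ) :
    e (-((inner ℝ l (v + μ) : ℝ) : ℂ)) = e (-((inner ℝ l v : ℝ) : ℂ)) := by
  obtain ⟨m, hm⟩ := hΛ.exists_inner_eq hl μ.2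
  rw [inner_add_right, hm, Complex.ofReal_add, neg_add, e_add,
    show (-((m : ℝ) : ℂ)) = ((-m : ℤ) : ℂ) by push_cast; ring, e_intCast, mul_one]

/-- The contribution of the denominator `n` to a Fourier coefficient. -/
noncomputable def fourierPart (Λ : Submodule ℤ E24) (l : E24) (k h : ℝ) (s : ℂ) (n : ℕ+) : ℂ :=
  ((n * h / 2 : ℝ) : ℂ) ^ (-s) *
    (∫ v, profile s (cNum k h n) v * e (-((inner ℝ l v : ℝ) : ℂ))) * jSum Λ l n

theorem summable_integral_norm_summand_mul_e (hΛ : IsLeechLattice Λ) (hh : 0 < h) (hk : 0 < k)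
    (hkh : 2 * h ^ 2 / k < 1) (hs : 25 < s.re) (l : E24) :
    Summable fun p : Bool × ShellIndex Λ =>
      ∫ v, ‖summand k h s p v * e (-((inner ℝ l v : ℝ) : ℂ))‖ := by
  simp_rw [norm_mul, norm_e_neg, mul_one]
  exact summable_integral_norm_summand hΛ hh hk hkh hs

/-- The contribution of a single class to a Fourier coefficient. -/
noncomputable def shellTerm (l : E24) (k h : ℝ) (s : ℂ) (i : ShellIndex Λ) : ℂ :=
  ((i.1 * h / 2 : ℝ) : ℂ) ^ (-s) *
    (∫ v, profile s (cNum k h i.1) v * e (-((inner ℝ l v : ℝ) : ℂ))) *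
      e (((inner ℝ (i.rep : E24) l : ℝ) : ℂ) / (i.1 : ℂ))

theorem summable_boolPhase_mul_shellTerm (hΛ : IsLeechLattice Λ) (hh : 0 < h) (hk : 0 < k)
    (hkh : 2 * h ^ 2 / k < 1) (hs : 25 < s.re) (l : E24) :
    Summable fun p : Bool × ShellIndex Λ => boolPhase s p.1 * shellTerm l k h s p.2 := by
  refine (summable_integral_norm_summand_mul_e hΛ hh hk hkh hs l).of_norm_bounded fun p => ?_
  rw [shellTerm, ← integral_summand_mul_e]
  exact norm_integral_le_integral_norm _

theorem summable_shellTerm (hΛ : IsLeechLattice Λ) (hh : 0 < h) (hk : 0 < k)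
    (hkh : 2 * h ^ 2 / k < 1) (hs : 25 < s.re) (l : E24) :
    Summable (shellTerm (Λ := Λ) l k h s) := by
  -- The sign `true` has phase 1.
  simpa [boolPhase] using (summable_boolPhase_mul_shellTerm hΛ hh hk hkh hs l).prod_factor true

theorem hasSum_fourierPart (hΛ : IsLeechLattice Λ) (hh : 0 < h) (hk : 0 < k)
    (hkh : 2 * h ^ 2 / k < 1) (hs : 25 < s.re) (l : E24) :
    HasSum (fourierPart Λ l k h s) (∑' i : ShellIndex Λ, shellTerm l k h s i) := by
  have key (n : ℕ+) : HasSum (fun q : shell Λ n 1 => shellTerm l k h s (⟨n, q⟩ : ShellIndex Λ))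
      (fourierPart Λ l k h s n) := by
    have h1 := hasSum_jSum hΛ l n
    have h2 := h1.mul_left (((n * h / 2 : ℝ) : ℂ) ^ (-s) *
      ∫ v, profile s (cNum k h n) v * e (-((inner ℝ l v : ℝ) : ℂ)))
    exact h2
  exact HasSum.sigma (summable_shellTerm hΛ hh hk hkh hs l).hasSum key

theorem fourierA_eq_tsum (hΛ : IsLeechLattice Λ) (hF : IsAddFundamentalDomain Λ F volume)
    (hh : 0 < h) (hk : 0 < k) (hkh : 2 * h ^ 2 / k < 1) (hs : 25 < s.re) {l : E24} (hl : l ∈ Λ) :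
    fourierA Λ F l k h s = (1 + e (-s / 2)) * ∑' n : ℕ+, fourierPart Λ l k h s n := by
  have := hΛ.countable
  have := fun n : ℕ+ => hΛ.finite_quotient n
  have hsum := summable_integral_norm_summand_mul_e hΛ hh hk hkh hs l
  have h1 := setIntegral_tsum_translates hF (fun p => integrable_mul_e
    (integrable_summand (Λ := Λ) hh hk hkh (by linarith : 12 < s.re) p) l) hsum
  -- For `l ∈ Λ` the character is `Λ`-periodic, so it factors out of the sum over translates.
  simp_rw [e_neg_inner_add hΛ hl, tsum_mul_right, ← poincareE_phi hΛ hh hk hkh] at h1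
  have h2 : ∀ p : Bool × ShellIndex Λ, ∫ v, summand k h s p v * e (-((inner ℝ l v : ℝ) : ℂ)) =
    boolPhase s p.1 * shellTerm l k h s p.2 := fun p => integral_summand_mul_e p l
  rw [fourierA, h1, tsum_congr h2,
    (summable_boolPhase_mul_shellTerm hΛ hh hk hkh hs l).tsum_prod,
    (hasSum_fourierPart hΛ hh hk hkh hs l).tsum_eq, tsum_fintype, Fintype.sum_bool]
  simp only [tsum_mul_left, boolPhase, if_true, Bool.false_eq_true, if_false]
  ring

theorem integrableOn_poincareE (hΛ : IsLeechLattice Λ) (hF : IsAddFundamentalDomain Λ F volume)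
    (hh : 0 < h) (hk : 0 < k) (hkh : 2 * h ^ 2 / k < 1) (hs : 25 < s.re) :
    IntegrableOn (fun v : E24 => poincareE Λ (phi k h v) s) F volume := by
  have := hΛ.countable
  have := fun n : ℕ+ => hΛ.finite_quotient n
  simp_rw [poincareE_phi hΛ hh hk hkh]
  exact integrableOn_tsum_translates hF (integrable_summand hh hk hkh (by linarith))
    (summable_integral_norm_summand hΛ hh hk hkh hs)

/-- The reason for the factor `(h/2π)^s`: it cancels `h` and the 2. -/
theorem normalization_cpow (hh : 0 < h) (n : ℕ+) :
    ((h / (2 * Real.pi) : ℝ) : ℂ) ^ s * ((n * h / 2 : ℝ) : ℂ) ^ (-s) =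
      (Real.pi : ℂ) ^ (-s) * (n : ℂ) ^ (-s) := by
  have hn : (0 : ℝ) < n := by positivity
  have hp := Real.pi_pos
  rw [show ((n : ℕ) : ℂ) = (((n : ℕ) : ℝ) : ℂ) by simp, cpow_eq_exp_log hn,
    cpow_eq_exp_log hp, cpow_eq_exp_log (by positivity),
    cpow_eq_exp_log (by positivity), ← Complex.exp_add, ← Complex.exp_add,
    Real.log_div hh.ne' (by positivity), Real.log_mul (by norm_num) hp.ne',
    Real.log_div (by positivity) (by norm_num), Real.log_mul hn.ne' hh.ne']
  congr 1
  push_cast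
  ring

theorem fourierPart_of_ne_zero (hh : 0 < h) (hk : 0 < k) (hkh : 2 * h ^ 2 / k < 1)
    (hs : 25 < s.re) {l : E24} (hl : l ≠ 0) (n : ℕ+) :
    ((h / (2 * Real.pi) : ℝ) : ℂ) ^ s * Complex.Gamma s * fourierPart Λ l k h s n =
      2 * (‖l‖ : ℂ) ^ (s - 12) * (jSum Λ l n * (n : ℂ) ^ (-s) * (cNum k h n : ℂ) ^ (12 - s) *
        besselK (12 - s) (2 * Real.pi * ‖l‖ * cNum k h n)) := by
  have hl' : 0 < ‖l‖ := norm_pos_iff.2 hl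
  have h1 := gamma_mul_fourier_profile (s := s) (by linarith) (cNum_pos hh hk hkh n) l
  rw [integral_eq_besselK (ν := s - 12) hl' (cNum_pos hh hk hkh n), neg_sub,
    Complex.mul_cpow_ofReal_nonneg Real.pi_pos.le hl'.le] at h1
  have hpi : (Real.pi : ℂ) ^ (-s) * (Real.pi : ℂ) ^ 12 * (Real.pi : ℂ) ^ (s - 12) = 1 := by
    have hp : (Real.pi : ℂ) ≠ 0 := by exact_mod_cast Real.pi_ne_zero
    rw [← Complex.cpow_natCast, ← Complex.cpow_add _ _ hp, ← Complex.cpow_add _ _ hp,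
      show -s + ((12 : ℕ) : ℂ) + (s - 12) = 0 by push_cast; ring, Complex.cpow_zero]
  have h2 := normalization_cpow (s := s) hh n
  calc _ = (((h / (2 * Real.pi) : ℝ) : ℂ) ^ s * ((n * h / 2 : ℝ) : ℂ) ^ (-s)) *
        (Complex.Gamma s * ∫ v, profile s (cNum k h n) v * e (-((inner ℝ l v : ℝ) : ℂ))) *
          jSum Λ l n := by rw [fourierPart]; ring
    _ = _ := by
      rw [h1, h2]
      linear_combination (2 * (‖l‖ : ℂ) ^ (s - 12) * (jSum Λ l n * (n : ℂ) ^ (-s) *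
        (cNum k h n : ℂ) ^ (12 - s) * besselK (12 - s) (2 * Real.pi * ‖l‖ * cNum k h n))) * hpi

theorem fourierPart_zero (hh : 0 < h) (hk : 0 < k) (hkh : 2 * h ^ 2 / k < 1)
    (hs : 25 < s.re) (n : ℕ+) :
    ((h / (2 * Real.pi) : ℝ) : ℂ) ^ s * Complex.Gamma s * fourierPart Λ 0 k h s n =
      Complex.Gamma (s - 12) * (Real.pi : ℂ) ^ (12 - s) *
        (jSum Λ 0 n * (n : ℂ) ^ (-s) * (cNum k h n : ℂ) ^ (24 - 2 * s)) := by
  have h1 := gamma_mul_integral_profile (s := s) (by linarith) (cNum_pos hh hk hkh n)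
  have hpi : (Real.pi : ℂ) ^ (-s) * (Real.pi : ℂ) ^ 12 = (Real.pi : ℂ) ^ (12 - s) := by
    have hp : (Real.pi : ℂ) ≠ 0 := by exact_mod_cast Real.pi_ne_zero
    rw [← Complex.cpow_natCast, ← Complex.cpow_add _ _ hp]
    congr 1
    push_cast
    ring
  have h2 := normalization_cpow (s := s) hh n
  calc _ = (((h / (2 * Real.pi) : ℝ) : ℂ) ^ s * ((n * h / 2 : ℝ) : ℂ) ^ (-s)) *
        (Complex.Gamma s * ∫ v, profile s (cNum k h n) v) * jSum Λ 0 n := by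
        simp only [fourierPart, inner_zero_left, Complex.ofReal_zero, neg_zero, e_zero, mul_one]
        ring
    _ = _ := by
      rw [h1, h2, ← hpi]
      ring

/-- Common end of both cases: `C` collects what does not depend on `n`, and `C ≠ 0` lets summability
pass to `f`. -/
theorem summable_and_fourierAStar_eq (hΛ : IsLeechLattice Λ)
    (hF : IsAddFundamentalDomain Λ F volume) (hh : 0 < h) (hk : 0 < k)
    (hkh : 2 * h ^ 2 / k < 1) (hs : 25 < s.re) {l : E24} (hl : l ∈ Λ) {C : ℂ} (hC : C ≠ 0)
    {f : ℕ+ → ℂ} (hf : ∀ n, ((h / (2 * Real.pi) : ℝ) : ℂ) ^ s * Complex.Gamma s *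
      fourierPart Λ l k h s n = C * f n) :
    Summable f ∧ fourierAStar Λ F l k h s = (1 + e (-s / 2)) * C * ∑' n, f n := by
  have h1 := (hasSum_fourierPart hΛ hh hk hkh hs l).summable.mul_left
    (((h / (2 * Real.pi) : ℝ) : ℂ) ^ s * Complex.Gamma s)
  simp_rw [hf] at h1
  refine ⟨(summable_mul_left_iff hC).1 h1, ?_⟩
  rw [fourierAStar, fourierA_eq_tsum hΛ hF hh hk hkh hs hl, mul_left_comm, ← tsum_mul_left]
  simp_rw [hf]
  rw [tsum_mul_left, mul_assoc]

end Expansion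
end LeechPoincare

/-! ### The main theorem -/

open LeechPoincare MeasureTheory
theorem mainTheorem2 (Λ : Submodule ℤ E24) (hΛ : IsLeechLattice Λ)
    (F : Set E24) (hF : IsAddFundamentalDomain Λ F volume)
    (k h : ℝ) (hk : 0 < k) (hh : 0 < h) (hkh : 2 * h ^ 2 / k < 1)
    (s : ℂ) (hs : 25 < s.re) :
    -- the series converges absolutely on `S_{k,h}`, which meets no mirror, and it defines an
    -- integrable function on the torus
    (∀ z ∈ orbitS k h, (∀ r ∈ roots Λ, form r z ≠ 0) ∧
      Summable (fun r : roots Λ => term s z r)) ∧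
    (∀ μ ∈ Λ, ∀ v : E24, poincareE Λ (phi k h (v + μ)) s = poincareE Λ (phi k h v) s) ∧
    IntegrableOn (fun v : E24 => poincareE Λ (phi k h v) s) F volume ∧
    -- the coefficients with nonzero index
    (∀ l ∈ Λ, l ≠ 0 →
      Summable (fun n : ℕ+ => jSum Λ l n * (n : ℂ) ^ (-s) * (cNum k h n : ℂ) ^ (12 - s) *
        besselK (12 - s) (2 * Real.pi * ‖l‖ * cNum k h n)) ∧
      fourierAStar Λ F l k h s =
        2 * (1 + e (-s / 2)) * (‖l‖ : ℂ) ^ (s - 12) *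
          ∑' n : ℕ+, jSum Λ l n * (n : ℂ) ^ (-s) * (cNum k h n : ℂ) ^ (12 - s) *
            besselK (12 - s) (2 * Real.pi * ‖l‖ * cNum k h n)) ∧
    -- the constant coefficient
    (Summable (fun n : ℕ+ => jSum Λ 0 n * (n : ℂ) ^ (-s) * (cNum k h n : ℂ) ^ (24 - 2 * s)) ∧
      fourierAStar Λ F 0 k h s =
        (1 + e (-s / 2)) * Complex.Gamma (s - 12) * (Real.pi : ℂ) ^ (12 - s) *
          ∑' n : ℕ+, jSum Λ 0 n * (n : ℂ) ^ (-s) * (cNum k h n : ℂ) ^ (24 - 2 * s)) := by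
  refine ⟨fun z hz => ?_, fun μ hμ v => poincareE_phi_add hΛ hh hk hkh hμ v,
    integrableOn_poincareE hΛ hF hh hk hkh hs, fun l hl hl0 => ?_, ?_⟩
  · obtain ⟨v, rfl⟩ := exists_phi_eq hh hz
    refine ⟨fun r hr => ?_, ?_⟩
    · obtain ⟨p, hp⟩ := rootParam_surjective hΛ ⟨r, hr⟩
      have hc := cNum_pos hh hk hkh p.1.2.1
      have := form_rootParam_phi hΛ hh hk hkh p v
      rw [hp] at this
      rw [this]
      exact mul_ne_zero (boolSign_ne_zero _) (by positivity)
    · rw [← (rootEquiv hΛ).summable_iff]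
      exact (summable_summand hΛ hF hh hk hkh hs v).congr
        fun p => (term_rootParam hΛ hh hk hkh p v).symm
  · have hl' : (‖l‖ : ℂ) ≠ 0 := by exact_mod_cast norm_ne_zero_iff.2 hl0
    have := summable_and_fourierAStar_eq hΛ hF hh hk hkh hs hl
      (mul_ne_zero two_ne_zero ((Complex.cpow_ne_zero_iff_of_exponent_ne_zero
        (fun h0 => by simpa [sub_eq_zero.1 h0] using hs.trans_le' (by norm_num : (12 : ℝ) ≤ 25))).2
          hl'))
      (fourierPart_of_ne_zero (Λ := Λ) hh hk hkh hs hl0)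
    refine ⟨this.1, this.2.trans ?_⟩
    ring
  · have := summable_and_fourierAStar_eq hΛ hF hh hk hkh hs Λ.zero_mem
      (mul_ne_zero (Complex.Gamma_ne_zero_of_re_pos (s := s - 12) (by simp; linarith))
        (by rw [Complex.cpow_def_of_ne_zero (by exact_mod_cast Real.pi_ne_zero)]
            exact Complex.exp_ne_zero _ : (Real.pi : ℂ) ^ (12 - s) ≠ 0))
      (fourierPart_zero (Λ := Λ) hh hk hkh hs)
    refine ⟨this.1, this.2.trans ?_⟩
    ring
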